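/- **Threads.** Fix an enumeration $(q_n)_{n\ge 1}$ of $\mathbb{Q}\cap(0,1)$. Let $\Delta$ be the set of decreasing (i.e. $\gamma_{i+1}\le\gamma_i$) real sequences $\gamma=(\gamma_i)_{i\ge 1}$ with $0<\gamma_i<2^{-(i+1)}$ for all $i$ and $q_1+\gamma_1<1$. For $\gamma\in\Delta$ put $G^\gamma_i=(q_{n_i},q_{n_i}+\gamma_i)$, where inductively $n_i$ is the least $n$ such that $(q_n,q_n+\gamma_i)\subset(0,1)\setminus\bigcup_{j<i}G^\gamma_j$ (so $n_1=1$), and let $T_\gamma=[0,1]\setminus\bigcup_i G^\gamma_i$. For $0<a\le 1$ let $T_\gamma(1,a)$ be the set $T_\gamma$ with the metric $d_{1,a}(x,y)=\min\{|x-y|,\,x+(1-y)+a,\,y+(1-x)+a\}$, so that $d_{1,a}(0,1)=a$. **Threading spaces.** For two points $A,B$ at distance $a\in(0,1]$, the threading space $\mathrm{Th}(A,B)$ is the metric space obtained from the disjoint union of all $T_\gamma(1,a)$, $\gamma\in\Delta$, by identifying all points $0$ with $A$ and all points $1$ with $B$. Each thread keeps its metric, and points $x,y$ of different threads have distance $\min\{d(x,A)+d(A,y),\,d(x,B)+d(B,y)\}$.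 **Skeins.** The increasing complete metric spaces $\mathrm{Sk}(\beta)$ are defined by transfinite recursion on the ordinal $\beta$. $\mathrm{Sk}(0)$ consists of two points at distance $1/2$. For a limit ordinal $\beta$, $\mathrm{Sk}(\beta)$ is the completion of $\bigcup_{\alpha<\beta}\mathrm{Sk}(\alpha)$. For $\beta=\lambda+1$, let $G_\lambda=\mathrm{Sk}(\lambda)\setminus\bigcup_{\alpha<\lambda}\mathrm{Sk}(\alpha)$. Then $\mathrm{Sk}(\lambda+1)$ is obtained from $\mathrm{Sk}(\lambda)$ by gluing, for each unordered pair $\{p,q\}\subset\mathrm{Sk}(\lambda)$ with $p\in G_\lambda$ or $q\in G_\lambda$ and $0<d(p,q)\le 1/2$, a copy of $\mathrm{Th}(A,B)$ with $d(A,B)=d(p,q)$, its anchors $A,B$ being identified with $p,q$ in an arbitrarily chosen order. Here $\mathrm{Sk}(\lambda)$ and each glued space $N$ keep their metrics. A non-anchor point $x$ of a glued space with anchor set $S_x$ has distance $\min_{s\in S_x}\{d(x,s)+d(s,y)\}$ to $y\in\mathrm{Sk}(\lambda)$, and distance $\min_{s\in S_x,\,t\in S_y}\{d(x,s)+d(s,t)+d(t,y)\}$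 to a non-anchor point $y$ of a different glued space. **Proposition.** Let $\omega_1$ be the first uncountable ordinal. For every enumeration $(q_n)$ and every choice of the orders in which anchors are identified, the following holds. Let $S$ be a closed subset of $\mathrm{Sk}(\omega_1)$ with at least two points. If some $p\in S$ is isolated in $S$, then $S$ is not a Lipschitz retract of $\mathrm{Sk}(\omega_1)$; that is, there is no Lipschitz map $R\colon\mathrm{Sk}(\omega_1)\to S$ with $R(x)=x$ for all $x\in S$. -/

import Mathlib

open Filter Topology Set

namespace SkeinSpace

/-! ## Threads -/

/-- The metric `d_{l,a}` of a thread of length `l` and width `a`. -/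
noncomputable def threadDist (l a x y : ℝ) : ℝ :=
  min |x - y| (min (x + (l - y) + a) (y + (l - x) + a))

/-- The set `Δ` of decreasing real sequences `γ` with `0 < γ_i < 2^{-(i+1)}` and `q_1 + γ_1 < 1`,
where `q` enumerates the rationals of `(0,1)`.
Sequences are indexed from `0`, so that `γ i` and `q n` stand for `γ_{i+1}` and `q_{n+1}`. -/
def Delta (q : ℕ ≃ Ioo (0 : ℚ) 1) : Set (ℕ → ℝ) :=
  {γ | Antitone γ ∧ (∀ i, 0 < γ i) ∧ (∀ i, γ i < (1 / 2) ^ (i + 2)) ∧ ((q 0 : ℚ) : ℝ) + γ 0 < 1}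

/-- The intervals `G_i^γ = (q_{n_i}, q_{n_i} + γ_i)`, where `n_i` is the least `n` such that
`(q_n, q_n + γ_i)` lies in `(0,1)` and misses all earlier intervals.
(For the first interval this is the first rational, by the last condition on `γ`.) -/
noncomputable def gap (q : ℕ ≃ Ioo (0 : ℚ) 1) (γ : ℕ → ℝ) (i : ℕ) : Set ℝ :=
  let n := sInf {n : ℕ | Ioo ((q n : ℚ) : ℝ) ((q n : ℚ) + γ i) ⊆
    Ioo 0 1 \ ⋃ j : Fin i, gap q γ j}
  Ioo ((q n : ℚ) : ℝ) ((q n : ℚ) + γ i)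
termination_by i
decreasing_by exact j.isLt

/-- The closed set `T_γ ⊆ [0,1]`. -/
def threadSet (q : ℕ ≃ Ioo (0 : ℚ) 1) (γ : ℕ → ℝ) : Set ℝ :=
  Icc 0 1 \ ⋃ i, gap q γ i

/-! ## Names of points

All skeins are built as sets of names, so that they are honestly increasing and the pieces which
are glued at one stage are disjoint from each other and from the previous skein. -/

/-- `base` names the two points of the `0`-skein; `thread p q γ t` names the point `t` of the
thread `T_γ(p,q)`, with `p` and `q` in the role of `0` and `1`; `lim s` names the limit of the
sequence `s` in a completion. -/
inductive Code : Type
  | base (b : Bool) : Code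
  | thread (p q : Code) (γ : ℕ → ℝ) (t : ℝ) : Code
  | lim (s : ℕ → Code) : Code

instance : Inhabited Code := ⟨Code.base false⟩

/-- The free choices in the construction: an enumeration of the rationals in `(0,1)`, and for any
two points `p ≠ q` the order in which they are the anchors `A, B` of the threading space glued at
`{p,q}`: `orient p q` says that `A = p` and `B = q`. -/
structure Choices where
  enum : ℕ ≃ Ioo (0 : ℚ) 1
  orient : Code → Code → Prop
  orient_iff : ∀ p q, p ≠ q → (orient p q ↔ ¬ orient q p)

/-- A stage `Sk(β)` of the construction: its set of points, the union `⋃_{α<β} Sk(α)` of the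
earlier stages, and its metric (only its values on `carrier` matter). -/
structure Stage where
  carrier : Set Code
  old : Set Code
  d : Code → Code → ℝ

/-- The generation `G_β = Sk(β) \ ⋃_{α<β} Sk(α)`. -/
def Stage.gen (X : Stage) : Set Code := X.carrier \ X.old

/-! ## Stage zero -/

open Classical in
/-- The `0`-skein: two points at distance `1/2`. -/
noncomputable def zeroStage : Stage where
  carrier := {Code.base false, Code.base true}
  old := ∅
  d x y := if x = y then 0 else 1 / 2

/-! ## Successor stages -/

/-- The (oriented) pairs `{p,q} ∈ Γ_λ` at which a threading space is glued. -/
def anchorPairs (c : Choices) (X : Stage) : Set (Code × Code) :=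
  {pq | pq.1 ∈ X.carrier ∧ pq.2 ∈ X.carrier ∧ (pq.1 ∈ X.gen ∨ pq.2 ∈ X.gen) ∧
    0 < X.d pq.1 pq.2 ∧ X.d pq.1 pq.2 ≤ 1 / 2 ∧ c.orient pq.1 pq.2}

/-- The points of the threading spaces `Th(p,q)`, `{p,q} ∈ Γ_λ`, other than the anchors. -/
def newPoints (c : Choices) (X : Stage) : Set Code :=
  {x | ∃ p q γ t, x = Code.thread p q γ t ∧ (p, q) ∈ anchorPairs c X ∧ γ ∈ Delta c.enum ∧
    t ∈ threadSet c.enum γ ∧ t ≠ 0 ∧ t ≠ 1}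

open Classical in
/-- The two points of `X` through which `x` is reached: the anchors (`false` for `A`, `true`
for `B`) of the threading space of `x` if `x` is new, and `x` itself if `x` is in `X`. -/
noncomputable def foot (X : Stage) (x : Code) (i : Bool) : Code :=
  if x ∈ X.carrier then x else
    match x with
    | Code.thread p q _ _ => if i then q else p
    | y => y

open Classical in
/-- The distance from `x` to `foot X x i`, inside the thread of `x` if `x` is new. -/
noncomputable def footDist (X : Stage) (x : Code) (i : Bool) : ℝ :=
  if x ∈ X.carrier then 0 else
    match x with
    | Code.thread p q _ t => threadDist 1 (X.d p q) t (if i then 1 else 0)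
    | _ => 0

/-- The distance through `X`: the minimum over the feet `a` of `x` and `b` of `y` of
`d(x,a) + d_X(a,b) + d(b,y)`. -/
noncomputable def distThrough (X : Stage) (x y : Code) : ℝ :=
  ⨅ ij : Bool × Bool,
    footDist X x ij.1 + X.d (foot X x ij.1) (foot X y ij.2) + footDist X y ij.2

open Classical in
/-- The metric of the attachment of `X` with the threading spaces. Two new points of the same
threading space have their distance in that space: the thread metric of width `d(p,q)` if they are
on the same thread, the shorter way through one of the anchors if they are on different threads.
In all other cases the distance is computed through `X`; in particular it is the old distance for
two points of `X`. -/
noncomputable def succDist (X : Stage) (x y : Code) : ℝ :=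
  if x ∈ X.carrier ∨ y ∈ X.carrier then distThrough X x y else
    match x, y with
    | Code.thread p q γ t, Code.thread p' q' γ' t' =>
      if p = p' ∧ q = q' then
        if γ = γ' then threadDist 1 (X.d p q) t t'
        else min (threadDist 1 (X.d p q) t 0 + threadDist 1 (X.d p q) 0 t')
          (threadDist 1 (X.d p q) t 1 + threadDist 1 (X.d p q) 1 t')
      else distThrough X x y
    | _, _ => distThrough X x y

/-- `Sk(λ+1)`: the attachment of `Sk(λ)` with the threading spaces `Th(p,q)`, `{p,q} ∈ Γ_λ`. -/
noncomputable def succStage (c : Choices) (X : Stage) : Stage where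
  carrier := X.carrier ∪ newPoints c X
  old := X.carrier
  d := succDist X

/-! ## Limit stages -/

section Limit

variable {κ : Ordinal.{0}}

/-- The union of the stages before `κ`. -/
def unionSet (F : Iio κ → Stage) : Set Code := ⋃ α, (F α).carrier

open Classical in
/-- The metric of the union: the distance of `x` and `y` is computed in the first stage which
contains both. -/
noncomputable def unionDist (F : Iio κ → Stage) (x y : Code) : ℝ :=
  if h : {α | x ∈ (F α).carrier ∧ y ∈ (F α).carrier}.Nonempty then
    (F ((wellFounded_lt (α := Iio κ)).min _ h)).d x y
  else 0

end Limit

/-- `s` is a Cauchy sequence in `W` for the metric `d`. -/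
def IsCauchyIn (W : Set Code) (d : Code → Code → ℝ) (s : ℕ → Code) : Prop :=
  (∀ n, s n ∈ W) ∧ ∀ ε > 0, ∃ N, ∀ m ≥ N, ∀ n ≥ N, d (s m) (s n) < ε

/-- The points which the completion of `W` adds to `W`: one for each class of equivalent Cauchy
sequences without limit in `W`, named by a chosen member of the class. -/
def limitPoints (W : Set Code) (d : Code → Code → ℝ) : Set Code :=
  {x | ∃ s, x = Code.lim s ∧ IsCauchyIn W d s ∧
    (¬ ∃ y ∈ W, Tendsto (fun n => d (s n) y) atTop (𝓝 0)) ∧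
    s = Classical.epsilon (fun s' : ℕ → Code =>
      IsCauchyIn W d s' ∧ Tendsto (fun n => d (s n) (s' n)) atTop (𝓝 0))}

open Classical in
/-- A sequence in `W` converging to the point `x` of the completion of `W`. -/
noncomputable def approx (W : Set Code) (x : Code) : ℕ → Code :=
  if x ∈ W then fun _ => x else
    match x with
    | Code.lim s => s
    | y => fun _ => y

/-- The metric of the completion of `W`. -/
noncomputable def completionDist (W : Set Code) (d : Code → Code → ℝ) (x y : Code) : ℝ :=
  limUnder atTop (fun n => d (approx W x n) (approx W y n))

/-- `Sk(κ)` for a limit ordinal `κ`: the completion of the union of the earlier skeins. -/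
noncomputable def limitStage {κ : Ordinal.{0}} (F : Iio κ → Stage) : Stage where
  carrier := unionSet F ∪ limitPoints (unionSet F) (unionDist F)
  old := unionSet F
  d := completionDist (unionSet F) (unionDist F)

/-! ## The skeins -/

/-- The transfinite construction. -/
noncomputable def stage (c : Choices) (β : Ordinal.{0}) : Stage :=
  Ordinal.limitRecOn (motive := fun _ => Stage) β zeroStage (fun _ X => succStage c X)
    (fun _ _ F => limitStage (fun α => F α.1 α.2))

theorem stage_zero (c : Choices) : stage c 0 = zeroStage :=
  Ordinal.limitRecOn_zero ..

theorem stage_add_one (c : Choices) (β : Ordinal.{0}) :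
    stage c (β + 1) = succStage c (stage c β) :=
  Ordinal.limitRecOn_add_one ..

theorem stage_limit (c : Choices) {β : Ordinal.{0}} (h : Order.IsSuccLimit β) :
    stage c β = limitStage (fun α : Iio β => stage c α) :=
  Ordinal.limitRecOn_limit _ _ _ _ h

/-! ## The skeins are metric spaces -/

/-- `d` is a metric on the set `A`. -/
structure IsMetricOn (A : Set Code) (d : Code → Code → ℝ) : Prop where
  self : ∀ x ∈ A, d x x = 0
  eq : ∀ x ∈ A, ∀ y ∈ A, d x y = 0 → x = y
  symm : ∀ x ∈ A, ∀ y ∈ A, d x y = d y x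
  tri : ∀ x ∈ A, ∀ y ∈ A, ∀ z ∈ A, d x z ≤ d x y + d y z

theorem IsMetricOn.nonneg {A : Set Code} {d : Code → Code → ℝ} (h : IsMetricOn A d)
    {x y : Code} (hx : x ∈ A) (hy : y ∈ A) : 0 ≤ d x y := by
  have h1 := h.tri x hx y hy x hx
  rw [h.self x hx, h.symm y hy x hx] at h1
  linarith

/-- `Y` contains `X` isometrically. -/
def Extends (X Y : Stage) : Prop :=
  X.carrier ⊆ Y.carrier ∧ ∀ x ∈ X.carrier, ∀ y ∈ X.carrier, Y.d x y = X.d x y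

theorem zeroStage_isMetricOn : IsMetricOn zeroStage.carrier zeroStage.d where
  self x _ := by simp [zeroStage]
  eq x _ y _ h := by
    by_contra hne
    simp [zeroStage, hne] at h
  symm x _ y _ := by
    rcases eq_or_ne x y with rfl | h
    · rfl
    · simp [zeroStage, h, h.symm]
  tri x _ y _ z _ := by
    simp only [zeroStage]
    split_ifs with h1 h2 h3 h3 h2 h3 h3 <;> first
      | norm_num; done
      | exact absurd (h2.trans h3) h1

/-! ### Threads -/

theorem threadDist_self {a x : ℝ} (ha : 0 < a) : threadDist 1 a x x = 0 := by
  unfold threadDist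
  rw [sub_self, abs_zero, min_eq_left]
  apply le_min <;> linarith

theorem threadDist_comm (a x y : ℝ) : threadDist 1 a x y = threadDist 1 a y x := by
  unfold threadDist
  rw [abs_sub_comm, min_comm (x + (1 - y) + a)]

theorem threadDist_pos {a x y : ℝ} (ha : 0 < a) (hx : x ∈ Icc (0 : ℝ) 1) (hy : y ∈ Icc (0 : ℝ) 1)
    (h : x ≠ y) : 0 < threadDist 1 a x y := by
  unfold threadDist
  refine lt_min (abs_pos.2 (sub_ne_zero.2 h)) (lt_min ?_ ?_) <;>
    linarith [hx.1, hx.2, hy.1, hy.2]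

theorem threadDist_nonneg {a x y : ℝ} (ha : 0 < a) (hx : x ∈ Icc (0 : ℝ) 1)
    (hy : y ∈ Icc (0 : ℝ) 1) : 0 ≤ threadDist 1 a x y := by
  rcases eq_or_ne x y with rfl | h
  · rw [threadDist_self ha]
  · exact (threadDist_pos ha hx hy h).le

theorem threadDist_tri {a x y z : ℝ} (ha : 0 < a) (hx : x ∈ Icc (0 : ℝ) 1)
    (hy : y ∈ Icc (0 : ℝ) 1) (hz : z ∈ Icc (0 : ℝ) 1) :
    threadDist 1 a x z ≤ threadDist 1 a x y + threadDist 1 a y z := by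
  obtain ⟨hx0, hx1⟩ := hx
  obtain ⟨hy0, hy1⟩ := hy
  obtain ⟨hz0, hz1⟩ := hz
  have h1 : threadDist 1 a x z ≤ |x - z| := min_le_left _ _
  have h2 : threadDist 1 a x z ≤ x + (1 - z) + a := (min_le_right _ _).trans (min_le_left _ _)
  have h3 : threadDist 1 a x z ≤ z + (1 - x) + a := (min_le_right _ _).trans (min_le_right _ _)
  have key : ∀ u v : ℝ, threadDist 1 a u v = |u - v| ∨ threadDist 1 a u v = u + (1 - v) + a ∨
      threadDist 1 a u v = v + (1 - u) + a := by
    intro u v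
    unfold threadDist
    rcases min_choice |u - v| (min (u + (1 - v) + a) (v + (1 - u) + a)) with h | h
    · exact Or.inl h
    · rw [h]
      exact Or.inr (min_choice _ _)
  rcases key x y with h | h | h <;> rcases key y z with h' | h' | h' <;> rw [h, h'] <;>
    rcases abs_cases (x - y) with h4 | h4 <;> rcases abs_cases (y - z) with h5 | h5 <;>
    rcases abs_cases (x - z) with h6 | h6 <;> linarith

theorem threadDist_zero_one {a : ℝ} (ha1 : a ≤ 1) : threadDist 1 a 0 1 = a := by
  unfold threadDist
  rw [min_eq_right, min_eq_left] <;> norm_num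
  linarith

/-! ### Successor stages -/

section Succ

variable {c : Choices} {X : Stage}

/-- Two new points of the same thread. -/
def SameThread (X : Stage) (x y : Code) : Prop :=
  x ∉ X.carrier ∧ y ∉ X.carrier ∧
    ∃ p q γ t t', x = Code.thread p q γ t ∧ y = Code.thread p q γ t'

theorem distThrough_le (X : Stage) (x y : Code) (i j : Bool) :
    distThrough X x y ≤ footDist X x i + X.d (foot X x i) (foot X y j) + footDist X y j :=
  ciInf_le (Set.finite_range _).bddBelow (i, j)

theorem exists_distThrough_eq (X : Stage) (x y : Code) : ∃ i j,
    distThrough X x y = footDist X x i + X.d (foot X x i) (foot X y j) + footDist X y j := by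
  obtain ⟨ij, h⟩ := exists_eq_ciInf_of_finite (f := fun ij : Bool × Bool =>
    footDist X x ij.1 + X.d (foot X x ij.1) (foot X y ij.2) + footDist X y ij.2)
  exact ⟨ij.1, ij.2, h.symm⟩

theorem foot_old {x : Code} (h : x ∈ X.carrier) (i : Bool) : foot X x i = x := if_pos h

theorem footDist_old {x : Code} (h : x ∈ X.carrier) (i : Bool) : footDist X x i = 0 := if_pos h

theorem foot_new {p q : Code} {γ : ℕ → ℝ} {t : ℝ} (h : Code.thread p q γ t ∉ X.carrier)
    (i : Bool) : foot X (Code.thread p q γ t) i = if i then q else p := if_neg h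

theorem footDist_new {p q : Code} {γ : ℕ → ℝ} {t : ℝ} (h : Code.thread p q γ t ∉ X.carrier)
    (i : Bool) : footDist X (Code.thread p q γ t) i =
      threadDist 1 (X.d p q) t (if i then 1 else 0) := if_neg h

theorem ite_mem_Icc (i : Bool) : (if i then 1 else 0 : ℝ) ∈ Icc (0 : ℝ) 1 := by
  cases i <;> simp

/-- What is used about a new point. -/
theorem new_spec {x : Code} (hx : x ∈ (succStage c X).carrier) (h : x ∉ X.carrier) :
    ∃ p q γ t, x = Code.thread p q γ t ∧ p ∈ X.carrier ∧ q ∈ X.carrier ∧ 0 < X.d p q ∧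
      X.d p q ≤ 1 ∧ t ∈ Icc (0 : ℝ) 1 ∧ t ≠ 0 ∧ t ≠ 1 := by
  rcases hx with hx | ⟨p, q, γ, t, rfl, ⟨h1, h2, _, h3, h4, _⟩, _, h5, h6, h7⟩
  · exact absurd hx h
  · exact ⟨p, q, γ, t, rfl, h1, h2, h3, by linarith, h5.1, h6, h7⟩

theorem foot_mem {x : Code} (hx : x ∈ (succStage c X).carrier) (i : Bool) :
    foot X x i ∈ X.carrier := by
  by_cases h : x ∈ X.carrier
  · rwa [foot_old h]
  · obtain ⟨p, q, γ, t, rfl, hp, hq, -⟩ := new_spec hx h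
    rw [foot_new h]
    cases i <;> simpa

theorem footDist_nonneg {x : Code} (hx : x ∈ (succStage c X).carrier) (i : Bool) :
    0 ≤ footDist X x i := by
  by_cases h : x ∈ X.carrier
  · rw [footDist_old h]
  · obtain ⟨p, q, γ, t, rfl, hp, hq, h1, h2, ht, -⟩ := new_spec hx h
    rw [footDist_new h]
    exact threadDist_nonneg h1 ht (ite_mem_Icc i)

theorem footDist_pos {x : Code} (hx : x ∈ (succStage c X).carrier) (h : x ∉ X.carrier)
    (i : Bool) : 0 < footDist X x i := by
  obtain ⟨p, q, γ, t, rfl, hp, hq, h1, h2, ht, h0, h1'⟩ := new_spec hx h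
  rw [footDist_new h]
  refine threadDist_pos h1 ht (ite_mem_Icc i) ?_
  cases i <;> simpa

theorem dist_foot_foot (hX : IsMetricOn X.carrier X.d) {x : Code}
    (hx : x ∈ (succStage c X).carrier) (i j : Bool) :
    X.d (foot X x i) (foot X x j) ≤ footDist X x i + footDist X x j := by
  by_cases h : x ∈ X.carrier
  · simp [foot_old h, footDist_old h, hX.self x h]
  · obtain ⟨p, q, γ, t, rfl, hp, hq, h1, h2, ht, -⟩ := new_spec hx h
    have h01 := threadDist_tri (z := 1) h1 (x := 0) (by simp) ht (by simp)
    rw [threadDist_zero_one h2, threadDist_comm] at h01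
    have n0 := threadDist_nonneg (y := 0) h1 ht (by simp)
    have n1 := threadDist_nonneg (y := 1) h1 ht (by simp)
    have hs := hX.symm p hp q hq
    have hpp := hX.self p hp
    have hqq := hX.self q hq
    simp only [foot_new h, footDist_new h]
    cases i <;> cases j <;> simp <;> linarith

theorem succDist_same {p q : Code} {γ : ℕ → ℝ} {t t' : ℝ}
    (h : Code.thread p q γ t ∉ X.carrier) (h' : Code.thread p q γ t' ∉ X.carrier) :
    succDist X (Code.thread p q γ t) (Code.thread p q γ t') = threadDist 1 (X.d p q) t t' := by
  simp [succDist, h, h']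

theorem succDist_not_same (hX : IsMetricOn X.carrier X.d) {x y : Code}
    (hx : x ∈ (succStage c X).carrier) (hy : y ∈ (succStage c X).carrier)
    (h : ¬ SameThread X x y) : succDist X x y = distThrough X x y := by
  by_cases hx' : x ∈ X.carrier
  · simp [succDist, hx']
  by_cases hy' : y ∈ X.carrier
  · simp [succDist, hy']
  obtain ⟨p, q, γ, t, rfl, hp, hq, h1, h2, ht, -⟩ := new_spec hx hx'
  obtain ⟨p', q', γ', t', rfl, hp', hq', h1', h2', ht', -⟩ := new_spec hy hy'
  by_cases hpq : p = p' ∧ q = q'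
  · obtain ⟨rfl, rfl⟩ := hpq
    have hγ : γ ≠ γ' := by
      rintro rfl
      exact h ⟨hx', hy', p, q, γ, t, t', rfl, rfl⟩
    simp only [succDist, hx', hy', hγ, or_self, if_false, and_self, if_true]
    apply le_antisymm
    · obtain ⟨i, j, hij⟩ := exists_distThrough_eq X (Code.thread p q γ t) (Code.thread p q γ' t')
      rw [hij]
      simp only [foot_new hx', foot_new hy', footDist_new hx', footDist_new hy']
      have hs := hX.symm p hp q hq
      have hpp := hX.self p hp
      have hqq := hX.self q hq
      have a1 := threadDist_tri h1 ht (y := 0) (z := 1) (by simp) (by simp)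
      rw [threadDist_zero_one h2] at a1
      have a2 := threadDist_tri h1 ht (y := 1) (z := 0) (by simp) (by simp)
      rw [threadDist_comm _ 1 0, threadDist_zero_one h2] at a2
      have l1 := min_le_left (threadDist 1 (X.d p q) t 0 + threadDist 1 (X.d p q) 0 t')
        (threadDist 1 (X.d p q) t 1 + threadDist 1 (X.d p q) 1 t')
      have l2 := min_le_right (threadDist 1 (X.d p q) t 0 + threadDist 1 (X.d p q) 0 t')
        (threadDist 1 (X.d p q) t 1 + threadDist 1 (X.d p q) 1 t')
      rw [threadDist_comm _ 0 t', threadDist_comm _ 1 t'] at *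
      cases i <;> cases j <;> simp only [if_true, Bool.false_eq_true, if_false] <;> linarith
    · apply le_min
      · refine (distThrough_le X _ _ false false).trans ?_
        simp [foot_new hx', foot_new hy', footDist_new hx', footDist_new hy', hX.self p hp,
          threadDist_comm _ 0 t']
      · refine (distThrough_le X _ _ true true).trans ?_
        simp [foot_new hx', foot_new hy', footDist_new hx', footDist_new hy', hX.self q hq,
          threadDist_comm _ 1 t']
  · simp [succDist, hx', hy', hpq]

theorem SameThread.symm {x y : Code} (h : SameThread X x y) : SameThread X y x := by
  obtain ⟨h1, h2, p, q, γ, t, t', rfl, rfl⟩ := h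
  exact ⟨h2, h1, p, q, γ, t', t, rfl, rfl⟩

theorem SameThread.trans {x y z : Code} (h : SameThread X x y) (h' : SameThread X y z) :
    SameThread X x z := by
  obtain ⟨h1, h2, p, q, γ, t, t', rfl, rfl⟩ := h
  obtain ⟨h3, h4, p', q', γ', u, u', e, rfl⟩ := h'
  cases e
  exact ⟨h1, h4, p, q, γ, t, u', rfl, rfl⟩

theorem SameThread.foot_le {x y : Code} (h : SameThread X x y)
    (hx : x ∈ (succStage c X).carrier) (hy : y ∈ (succStage c X).carrier) (i : Bool) :
    foot X x i = foot X y i ∧ footDist X x i ≤ succDist X x y + footDist X y i := by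
  obtain ⟨h1, h2, p, q, γ, t, t', rfl, rfl⟩ := h
  obtain ⟨p, q, γ, t, e, hp, hq, ha, ha1, ht, -⟩ := new_spec hx h1
  cases e
  obtain ⟨p, q, γ, t', e, -, -, -, -, ht', -⟩ := new_spec hy h2
  cases e
  rw [foot_new h1, foot_new h2, footDist_new h1, footDist_new h2, succDist_same h1 h2]
  exact ⟨rfl, threadDist_tri ha ht ht' (ite_mem_Icc i)⟩

theorem SameThread.le_distThrough (hX : IsMetricOn X.carrier X.d) {x y : Code}
    (h : SameThread X x y) (hx : x ∈ (succStage c X).carrier)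
    (hy : y ∈ (succStage c X).carrier) : succDist X x y ≤ distThrough X x y := by
  obtain ⟨h1, h2, p, q, γ, t, t', rfl, rfl⟩ := h
  obtain ⟨p, q, γ, t, e, hp, hq, ha, ha1, ht, -⟩ := new_spec hx h1
  cases e
  obtain ⟨p, q, γ, t', e, -, -, -, -, ht', -⟩ := new_spec hy h2
  cases e
  obtain ⟨i, j, hij⟩ := exists_distThrough_eq X (Code.thread p q γ t) (Code.thread p q γ t')
  rw [hij, succDist_same h1 h2, footDist_new h1, footDist_new h2, foot_new h1, foot_new h2]
  have hd : threadDist 1 (X.d p q) (if i then 1 else 0) (if j then 1 else 0) ≤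
      X.d (if i then q else p) (if j then q else p) := by
    cases i <;> cases j <;>
      simp [threadDist_self ha, hX.self p hp, hX.self q hq, threadDist_zero_one ha1,
        threadDist_comm _ 1 0, hX.symm q hq p hp]
  have e1 := threadDist_tri ha ht (ite_mem_Icc i) ht'
  have e2 := threadDist_tri ha (ite_mem_Icc i) (ite_mem_Icc j) ht'
  rw [threadDist_comm _ t' (if j then 1 else 0)]
  linarith

theorem succDist_le (hX : IsMetricOn X.carrier X.d) {x y : Code}
    (hx : x ∈ (succStage c X).carrier) (hy : y ∈ (succStage c X).carrier) (i j : Bool) :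
    succDist X x y ≤ footDist X x i + X.d (foot X x i) (foot X y j) + footDist X y j := by
  refine le_trans ?_ (distThrough_le X x y i j)
  by_cases h : SameThread X x y
  · exact h.le_distThrough hX hx hy
  · exact (succDist_not_same hX hx hy h).le

theorem succDist_comm (hX : IsMetricOn X.carrier X.d) {x y : Code}
    (hx : x ∈ (succStage c X).carrier) (hy : y ∈ (succStage c X).carrier) :
    succDist X x y = succDist X y x := by
  have aux : ∀ x y, x ∈ (succStage c X).carrier → y ∈ (succStage c X).carrier →
      succDist X x y ≤ succDist X y x := by
    intro x y hx hy
    by_cases h : SameThread X x y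
    · obtain ⟨h1, h2, p, q, γ, t, t', rfl, rfl⟩ := h
      rw [succDist_same h1 h2, succDist_same h2 h1, threadDist_comm]
    · rw [succDist_not_same hX hy hx (fun h' => h h'.symm)]
      obtain ⟨i, j, hij⟩ := exists_distThrough_eq X y x
      have := succDist_le hX hx hy j i
      rw [hX.symm _ (foot_mem hx j) _ (foot_mem hy i)] at this
      linarith
  exact le_antisymm (aux x y hx hy) (aux y x hy hx)

theorem succDist_old {x y : Code} (hx : x ∈ X.carrier)
    (hy : y ∈ X.carrier) : succDist X x y = X.d x y := by
  have h : succDist X x y = distThrough X x y := by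
    unfold succDist
    exact if_pos (Or.inl hx)
  rw [h]
  obtain ⟨i, j, hij⟩ := exists_distThrough_eq X x y
  rw [hij, foot_old hx, foot_old hy, footDist_old hx, footDist_old hy]
  ring

theorem succStage_isMetricOn (hX : IsMetricOn X.carrier X.d) :
    IsMetricOn (succStage c X).carrier (succStage c X).d where
  self x hx := by
    change succDist X x x = 0
    by_cases h : x ∈ X.carrier
    · rw [succDist_old h h, hX.self x h]
    · obtain ⟨p, q, γ, t, rfl, hp, hq, ha, -⟩ := new_spec hx h
      rw [succDist_same h h, threadDist_self ha]
  eq x hx y hy h := by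
    change succDist X x y = 0 at h
    by_cases hs : SameThread X x y
    · obtain ⟨h1, h2, p, q, γ, t, t', rfl, rfl⟩ := hs
      obtain ⟨p, q, γ, t, e, hp, hq, ha, ha1, ht, -⟩ := new_spec hx h1
      cases e
      obtain ⟨p, q, γ, t', e, -, -, -, -, ht', -⟩ := new_spec hy h2
      cases e
      rw [succDist_same h1 h2] at h
      by_contra hne
      have : t ≠ t' := by
        rintro rfl
        exact hne rfl
      exact (threadDist_pos ha ht ht' this).ne' h
    · rw [succDist_not_same hX hx hy hs] at h
      obtain ⟨i, j, hij⟩ := exists_distThrough_eq X x y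
      have n1 := footDist_nonneg hx i
      have n2 := footDist_nonneg hy j
      have n3 := hX.nonneg (foot_mem hx i) (foot_mem hy j)
      have hx' : x ∈ X.carrier := by
        by_contra hx'
        have := footDist_pos hx hx' i
        linarith
      have hy' : y ∈ X.carrier := by
        by_contra hy'
        have := footDist_pos hy hy' j
        linarith
      rw [foot_old hx', foot_old hy'] at hij n3
      exact hX.eq x hx' y hy' (by linarith)
  symm x hx y hy := succDist_comm hX hx hy
  tri x hx y hy z hz := by
    change succDist X x z ≤ succDist X x y + succDist X y z
    by_cases hxy : SameThread X x y
    · by_cases hyz : SameThread X y z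
      · obtain ⟨h1, h2, p, q, γ, t, t', rfl, rfl⟩ := hxy
        obtain ⟨-, h3, p, q, γ, t', t'', e, rfl⟩ := hyz
        cases e
        obtain ⟨p, q, γ, t, e, hp, hq, ha, ha1, ht, -⟩ := new_spec hx h1
        cases e
        obtain ⟨p, q, γ, t', e, -, -, -, -, ht', -⟩ := new_spec hy h2
        cases e
        obtain ⟨p, q, γ, t'', e, -, -, -, -, ht'', -⟩ := new_spec hz h3
        cases e
        rw [succDist_same h1 h2, succDist_same h2 h3, succDist_same h1 h3]
        exact threadDist_tri ha ht ht' ht''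
      · rw [succDist_not_same hX hy hz hyz]
        obtain ⟨i, j, hij⟩ := exists_distThrough_eq X y z
        obtain ⟨e1, e2⟩ := hxy.foot_le hx hy i
        have := succDist_le hX hx hz i j
        rw [e1] at this
        linarith
    · rw [succDist_not_same hX hx hy hxy]
      obtain ⟨i, j, hij⟩ := exists_distThrough_eq X x y
      by_cases hyz : SameThread X y z
      · obtain ⟨e1, e2⟩ := hyz.symm.foot_le hz hy j
        have := succDist_le hX hx hz i j
        rw [e1] at this
        rw [succDist_comm hX hz hy] at e2
        linarith
      · rw [succDist_not_same hX hy hz hyz]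
        obtain ⟨k, l, hkl⟩ := exists_distThrough_eq X y z
        have h1 := succDist_le hX hx hz i l
        have h2 := dist_foot_foot hX hy j k
        have h3 := hX.tri _ (foot_mem hx i) _ (foot_mem hy j) _ (foot_mem hz l)
        have h4 := hX.tri _ (foot_mem hy j) _ (foot_mem hy k) _ (foot_mem hz l)
        linarith

theorem succStage_extends : Extends X (succStage c X) :=
  ⟨subset_union_left, fun _ hx _ hy => succDist_old hx hy⟩

end Succ

/-! ### Unions -/

section Union

variable {κ : Ordinal.{0}} {F : Iio κ → Stage}

theorem unionDist_eq (hF : ∀ α β, α ≤ β → Extends (F α) (F β)) {x y : Code} {α : Iio κ}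
    (hx : x ∈ (F α).carrier) (hy : y ∈ (F α).carrier) : unionDist F x y = (F α).d x y := by
  have hα : α ∈ {α | x ∈ (F α).carrier ∧ y ∈ (F α).carrier} := ⟨hx, hy⟩
  have h : {α | x ∈ (F α).carrier ∧ y ∈ (F α).carrier}.Nonempty := ⟨α, hα⟩
  rw [unionDist, dif_pos h]
  have hm := (wellFounded_lt (α := Iio κ)).min_mem _ h
  have hle : (wellFounded_lt (α := Iio κ)).min _ h ≤ α :=
    not_lt.1 ((wellFounded_lt (α := Iio κ)).not_lt_min _ hα)
  exact ((hF _ _ hle).2 x hm.1 y hm.2).symm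

theorem unionDist_isMetricOn (hM : ∀ α, IsMetricOn (F α).carrier (F α).d)
    (hF : ∀ α β, α ≤ β → Extends (F α) (F β)) : IsMetricOn (unionSet F) (unionDist F) := by
  have common : ∀ x ∈ unionSet F, ∀ y ∈ unionSet F, ∃ α, x ∈ (F α).carrier ∧
      y ∈ (F α).carrier := by
    intro x hx y hy
    obtain ⟨α, hα⟩ := mem_iUnion.1 hx
    obtain ⟨β, hβ⟩ := mem_iUnion.1 hy
    exact ⟨max α β, (hF _ _ (le_max_left _ _)).1 hα, (hF _ _ (le_max_right _ _)).1 hβ⟩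
  refine ⟨fun x hx => ?_, fun x hx y hy h => ?_, fun x hx y hy => ?_, fun x hx y hy z hz => ?_⟩
  · obtain ⟨α, h1, h2⟩ := common x hx x hx
    rw [unionDist_eq hF h1 h2, (hM α).self x h1]
  · obtain ⟨α, h1, h2⟩ := common x hx y hy
    rw [unionDist_eq hF h1 h2] at h
    exact (hM α).eq x h1 y h2 h
  · obtain ⟨α, h1, h2⟩ := common x hx y hy
    rw [unionDist_eq hF h1 h2, unionDist_eq hF h2 h1, (hM α).symm x h1 y h2]
  · obtain ⟨α, h1, h2⟩ := common x hx y hy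
    obtain ⟨β, -, h3⟩ := common x hx z hz
    have h1' := (hF _ _ (le_max_left α β)).1 h1
    have h2' := (hF _ _ (le_max_left α β)).1 h2
    have h3' := (hF _ _ (le_max_right α β)).1 h3
    rw [unionDist_eq hF h1' h2', unionDist_eq hF h2' h3', unionDist_eq hF h1' h3']
    exact (hM _).tri x h1' y h2' z h3'

end Union

/-! ### Completions -/

section Completion

variable {W : Set Code} {d : Code → Code → ℝ}

theorem approx_old {x : Code} (h : x ∈ W) : approx W x = fun _ => x := if_pos h

theorem approx_new {s : ℕ → Code} (h : Code.lim s ∉ W) : approx W (Code.lim s) = s := if_neg h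

theorem approx_cauchy (hd : IsMetricOn W d) {x : Code} (hx : x ∈ W ∪ limitPoints W d) :
    IsCauchyIn W d (approx W x) := by
  by_cases h : x ∈ W
  · rw [approx_old h]
    refine ⟨fun _ => h, fun ε hε => ⟨0, fun m _ n _ => ?_⟩⟩
    simpa [hd.self x h] using hε
  · rcases hx with hx | ⟨s, rfl, hs, -⟩
    · exact absurd hx h
    · rwa [approx_new h]

theorem cauchy_dist_tendsto (hd : IsMetricOn W d) {s s' : ℕ → Code} (hs : IsCauchyIn W d s)
    (hs' : IsCauchyIn W d s') : ∃ r, Tendsto (fun n => d (s n) (s' n)) atTop (𝓝 r) := by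
  apply cauchySeq_tendsto_of_complete
  rw [Metric.cauchySeq_iff]
  intro ε hε
  obtain ⟨N, hN⟩ := hs.2 (ε / 2) (half_pos hε)
  obtain ⟨N', hN'⟩ := hs'.2 (ε / 2) (half_pos hε)
  refine ⟨max N N', fun m hm n hn => ?_⟩
  have a1 := hN m (le_of_max_le_left hm) n (le_of_max_le_left hn)
  have a2 := hN' m (le_of_max_le_right hm) n (le_of_max_le_right hn)
  have t1 := hd.tri _ (hs.1 m) _ (hs.1 n) _ (hs'.1 m)
  have t2 := hd.tri _ (hs.1 n) _ (hs'.1 n) _ (hs'.1 m)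
  have t3 := hd.tri _ (hs.1 n) _ (hs.1 m) _ (hs'.1 n)
  have t4 := hd.tri _ (hs.1 m) _ (hs'.1 m) _ (hs'.1 n)
  have e1 := hd.symm _ (hs.1 m) _ (hs.1 n)
  have e2 := hd.symm _ (hs'.1 m) _ (hs'.1 n)
  rw [Real.dist_eq, abs_lt]
  constructor <;> linarith

theorem completionDist_tendsto (hd : IsMetricOn W d) {x y : Code}
    (hx : x ∈ W ∪ limitPoints W d) (hy : y ∈ W ∪ limitPoints W d) :
    Tendsto (fun n => d (approx W x n) (approx W y n)) atTop (𝓝 (completionDist W d x y)) :=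
  tendsto_nhds_limUnder (cauchy_dist_tendsto hd (approx_cauchy hd hx) (approx_cauchy hd hy))

theorem completionDist_old {x y : Code} (hx : x ∈ W) (hy : y ∈ W) :
    completionDist W d x y = d x y := by
  rw [completionDist, approx_old hx, approx_old hy]
  exact tendsto_const_nhds.limUnder_eq

theorem completion_isMetricOn (hd : IsMetricOn W d) :
    IsMetricOn (W ∪ limitPoints W d) (completionDist W d) := by
  have symm' : ∀ x ∈ W ∪ limitPoints W d, ∀ y ∈ W ∪ limitPoints W d,
      completionDist W d x y = completionDist W d y x := by
    intro x hx y hy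
    refine tendsto_nhds_unique (completionDist_tendsto hd hx hy)
      ((completionDist_tendsto hd hy hx).congr fun n => ?_)
    exact hd.symm _ ((approx_cauchy hd hy).1 n) _ ((approx_cauchy hd hx).1 n)
  have mixed : ∀ x ∈ W, ∀ y ∈ W ∪ limitPoints W d, completionDist W d y x = 0 → x = y := by
    intro x hx y hy h
    have ht := completionDist_tendsto hd hy (Or.inl hx)
    rw [h, approx_old hx] at ht
    by_cases hy' : y ∈ W
    · rw [completionDist_old hy' hx] at h
      exact (hd.eq y hy' x hx h).symm
    · rcases hy with hy | ⟨s, rfl, hs, hn, -⟩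
      · exact absurd hy hy'
      · rw [approx_new hy'] at ht
        exact absurd ⟨x, hx, ht⟩ hn
  refine ⟨fun x hx => ?_, fun x hx y hy h => ?_, symm', fun x hx y hy z hz => ?_⟩
  · refine tendsto_nhds_unique (completionDist_tendsto hd hx hx)
      (tendsto_const_nhds.congr fun n => ?_)
    exact (hd.self _ ((approx_cauchy hd hx).1 n)).symm
  · by_cases hx' : x ∈ W
    · exact mixed x hx' y hy (by rw [symm' y hy x hx, h])
    by_cases hy' : y ∈ W
    · exact (mixed y hy' x hx h).symm
    have ht := completionDist_tendsto hd hx hy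
    rw [h] at ht
    rcases hx with hx | ⟨s, rfl, hs, -, hse⟩
    · exact absurd hx hx'
    rcases hy with hy | ⟨s', rfl, hs', -, hse'⟩
    · exact absurd hy hy'
    rw [approx_new hx', approx_new hy'] at ht
    have step : ∀ a b u : ℕ → Code, IsCauchyIn W d a → IsCauchyIn W d b → IsCauchyIn W d u →
        Tendsto (fun n => d (a n) (b n)) atTop (𝓝 0) →
        Tendsto (fun n => d (a n) (u n)) atTop (𝓝 0) →
        Tendsto (fun n => d (b n) (u n)) atTop (𝓝 0) := by
      intro a b u ha hb hu h1 h2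
      have h3 := h1.add h2
      rw [add_zero] at h3
      refine squeeze_zero (fun n => hd.nonneg (hb.1 n) (hu.1 n)) (fun n => ?_) h3
      rw [hd.symm _ (ha.1 n) _ (hb.1 n)]
      exact hd.tri _ (hb.1 n) _ (ha.1 n) _ (hu.1 n)
    have ht' : Tendsto (fun n => d (s' n) (s n)) atTop (𝓝 0) :=
      ht.congr fun n => hd.symm _ (hs.1 n) _ (hs'.1 n)
    have hp : (fun u : ℕ → Code => IsCauchyIn W d u ∧
          Tendsto (fun n => d (s n) (u n)) atTop (𝓝 0)) =
        fun u => IsCauchyIn W d u ∧ Tendsto (fun n => d (s' n) (u n)) atTop (𝓝 0) := by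
      funext u
      exact propext ⟨fun hu => ⟨hu.1, step s s' u hs hs' hu.1 ht hu.2⟩,
        fun hu => ⟨hu.1, step s' s u hs' hs hu.1 ht' hu.2⟩⟩
    rw [hp, ← hse'] at hse
    rw [hse]
  · refine le_of_tendsto_of_tendsto' (completionDist_tendsto hd hx hz)
      ((completionDist_tendsto hd hx hy).add (completionDist_tendsto hd hy hz)) fun n => ?_
    exact hd.tri _ ((approx_cauchy hd hx).1 n) _ ((approx_cauchy hd hy).1 n) _
      ((approx_cauchy hd hz).1 n)

end Completion

/-! ### All stages -/

theorem stage_spec (c : Choices) (β : Ordinal.{0}) :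
    IsMetricOn (stage c β).carrier (stage c β).d ∧
      ∀ α ≤ β, Extends (stage c α) (stage c β) := by
  induction β using Ordinal.limitRecOn with
  | zero =>
    refine ⟨?_, fun α hα => ?_⟩
    · rw [stage_zero]
      exact zeroStage_isMetricOn
    · rw [le_antisymm hα (zero_le)]
      exact ⟨subset_rfl, fun _ _ _ _ => rfl⟩
  | add_one β ih =>
    refine ⟨?_, fun α hα => ?_⟩
    · rw [stage_add_one]
      exact succStage_isMetricOn ih.1
    · rcases hα.eq_or_lt with rfl | hlt
      · exact ⟨subset_rfl, fun _ _ _ _ => rfl⟩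
      · have h1 := ih.2 α (Order.lt_add_one_iff.1 hlt)
        have h2 : Extends (stage c β) (stage c (β + 1)) := by
          rw [stage_add_one]
          exact succStage_extends
        exact ⟨h1.1.trans h2.1, fun x hx y hy =>
          (h2.2 x (h1.1 hx) y (h1.1 hy)).trans (h1.2 x hx y hy)⟩
  | limit β hβ ih =>
    have hF : ∀ α α' : Iio β, α ≤ α' → Extends (stage c α) (stage c α') :=
      fun α α' h => (ih α' α'.2).2 α h
    have hU := unionDist_isMetricOn (F := fun α : Iio β => stage c α)
      (fun α => (ih α α.2).1) hF
    refine ⟨?_, fun α hα => ?_⟩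
    · rw [stage_limit c hβ]
      exact completion_isMetricOn hU
    · rcases hα.eq_or_lt with rfl | hlt
      · exact ⟨subset_rfl, fun _ _ _ _ => rfl⟩
      · rw [stage_limit c hβ]
        have hsub : (stage c α).carrier ⊆ unionSet (fun α : Iio β => stage c α) :=
          subset_iUnion (fun α : Iio β => (stage c α).carrier) ⟨α, hlt⟩
        refine ⟨hsub.trans subset_union_left, fun x hx y hy => ?_⟩
        exact (completionDist_old (hsub hx) (hsub hy)).trans
          (unionDist_eq (α := ⟨α, hlt⟩) hF hx hy)

/-- The `β`-skein metric space `Sk(β)`. -/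
def Sk (c : Choices) (β : Ordinal.{0}) : Type := (stage c β).carrier

noncomputable instance (c : Choices) (β : Ordinal.{0}) : MetricSpace (Sk c β) where
  dist x y := (stage c β).d x.1 y.1
  dist_self x := (stage_spec c β).1.self x.1 x.2
  dist_comm x y := (stage_spec c β).1.symm x.1 x.2 y.1 y.2
  dist_triangle x y z := (stage_spec c β).1.tri x.1 x.2 y.1 y.2 z.1 z.2
  eq_of_dist_eq_zero h := Subtype.ext ((stage_spec c β).1.eq _ (Subtype.prop _) _
    (Subtype.prop _) h)

/-- `S` is a Lipschitz retract of `M`: there is a Lipschitz map `M → S` which is the identity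
on `S`. -/
def IsLipschitzRetract {M : Type*} [MetricSpace M] (S : Set M) : Prop :=
  ∃ (R : M → S) (K : NNReal), LipschitzWith K R ∧ ∀ x : S, R x = x

end SkeinSpace

namespace SkeinSpace

/-! ## Threads with short gaps -/

/-! If `p` is isolated in `S` and `R` is a Lipschitz retraction onto `S`, then the predicate `R x =
p` cannot change between points closer than a fixed `ε > 0`: the value `R y` would lie within the
isolation radius of `p`, hence equal `p`. It is therefore enough that any two points of the skein
are joined by a finite chain of steps shorter than `ε`. The predicate is then constant, although it
holds at `p` and fails at every other point of `S`.

Threads are totally disconnected, but `Δ` contains sequences of arbitrarily small sum, so some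
thread between two given anchors has no gap as long as a prescribed length and can be walked in
short steps (`exists_delta_inter_Ioo_nonempty`, `iff_of_anchorPair`). Any two distinct points at
distance at most `1/2` become anchors right after the first stage that contains both
(`iff_of_dist_le_half`). Transfinite induction then links every point to a base point
(`iff_base_of_mem`): a new point lies within `1/2` of one of its anchors, and a point of a
completion lies within `ε` of an earlier point. Of `ω₁` only the fact that it is a limit ordinal
enters. -/

/-- The length does not depend on which `n` the infimum selects, nor on whether it is the default
`0` of an empty set, so the position of the gap never has to be known. -/
theorem volume_gap (q : ℕ ≃ Ioo (0 : ℚ) 1) (γ : ℕ → ℝ) (i : ℕ) :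
    MeasureTheory.volume (gap q γ i) = ENNReal.ofReal (γ i) := by
  rw [gap]
  simp

/-- For every `r > 0` some `γ ∈ Δ` has gaps of total length less than `r`. -/
theorem exists_delta_inter_Ioo_nonempty (q : ℕ ≃ Ioo (0 : ℚ) 1) {r : ℝ} (hr : 0 < r) :
    ∃ γ ∈ Delta q, ∀ a b : ℝ, 0 ≤ a → b ≤ 1 → r ≤ b - a →
      (Ioo a b ∩ threadSet q γ).Nonempty := by
  obtain ⟨h0, h1⟩ := (q 0).2
  have h0' : (0 : ℝ) < ((q 0 : ℚ) : ℝ) := by exact_mod_cast h0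
  have h1' : ((q 0 : ℚ) : ℝ) < 1 := by exact_mod_cast h1
  -- The bound `r` keeps the total gap length `η / 2` below `r`. The bound `1 - q 0` gives `η < 1`,
  -- hence the termwise bounds of `Δ`, and keeps the first gap inside `(0,1)`.
  set η : ℝ := min r (1 - ((q 0 : ℚ) : ℝ)) with hη
  have hη0 : 0 < η := lt_min hr (by linarith)
  have hηr : η ≤ r := min_le_left _ _
  have hη1 : η ≤ 1 - ((q 0 : ℚ) : ℝ) := min_le_right _ _
  have hsum : HasSum (fun i : ℕ => η * (1 / 2 : ℝ) ^ (i + 2)) (η / 2) := by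
    have h := (hasSum_geometric_two).mul_left (η / 4)
    rw [show η / 4 * 2 = η / 2 by ring] at h
    have e : (fun i : ℕ => η * (1 / 2 : ℝ) ^ (i + 2)) = fun i => η / 4 * (1 / 2) ^ i := by
      funext i
      ring
    rwa [e]
  refine ⟨fun i => η * (1 / 2) ^ (i + 2), ⟨?_, fun i => by positivity, fun i => ?_, ?_⟩, ?_⟩
  · intro i j hij
    exact mul_le_mul_of_nonneg_left
      (pow_le_pow_of_le_one (by norm_num) (by norm_num) (by omega)) hη0.le
  · exact mul_lt_of_lt_one_left (by positivity) (by linarith)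
  · norm_num
    linarith
  · intro a b ha hb hab
    by_contra hne
    rw [Set.not_nonempty_iff_eq_empty] at hne
    -- An interval missing the thread would be covered by the gaps, and countable subadditivity
    -- would give `r ≤ b - a ≤ η / 2 ≤ r / 2`.
    have hsub : Ioo a b ⊆ ⋃ i, gap q (fun i => η * (1 / 2) ^ (i + 2)) i := by
      intro t ht
      by_contra hg
      have : t ∈ Ioo a b ∩ threadSet q (fun i => η * (1 / 2) ^ (i + 2)) :=
        ⟨ht, ⟨by linarith [ht.1], by linarith [ht.2]⟩, hg⟩
      rw [hne] at this
      exact this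
    have h := (MeasureTheory.measure_mono (μ := MeasureTheory.volume) hsub).trans
      (MeasureTheory.measure_iUnion_le _)
    simp only [volume_gap] at h
    rw [← ENNReal.ofReal_tsum_of_nonneg (fun i => by positivity) hsum.summable, hsum.tsum_eq,
      Real.volume_Ioo, ENNReal.ofReal_le_ofReal_iff (by positivity)] at h
    linarith

/-! ## Points of the stages -/

/-- The field `old` is set separately in each of the three cases of the recursion; this identifies
it with the intended union. -/
theorem stage_old (c : Choices) (β : Ordinal.{0}) {x : Code} :
    x ∈ (stage c β).old ↔ ∃ α < β, x ∈ (stage c α).carrier := by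
  rcases Ordinal.zero_or_succ_or_isSuccLimit β with rfl | ⟨β, rfl⟩ | hβ
  · rw [stage_zero]
    simp [zeroStage]
  · simp only [Order.succ_eq_add_one, stage_add_one]
    refine ⟨fun h => ⟨β, Order.lt_succ β, h⟩, fun ⟨α, hα, h⟩ => ?_⟩
    exact ((stage_spec c β).2 α (Order.lt_add_one_iff.1 hα)).1 h
  · rw [stage_limit c hβ]
    simp [limitStage, unionSet]

/-- Thread names enter only at successor stages, where both anchors are already present; completions
add only names of the form `lim`. -/
theorem anchors_of_thread_mem (c : Choices) (β : Ordinal.{0}) {p q : Code} {γ : ℕ → ℝ} {t : ℝ}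
    (h : Code.thread p q γ t ∈ (stage c β).carrier) :
    ∃ α < β, p ∈ (stage c α).carrier ∧ q ∈ (stage c α).carrier := by
  induction β using Ordinal.limitRecOn with
  | zero =>
    rw [stage_zero] at h
    simp [zeroStage] at h
  | add_one β ih =>
    rw [stage_add_one] at h
    rcases h with h | ⟨p', q', γ', t', e, hpq, -⟩
    · obtain ⟨α, hα, h'⟩ := ih h
      exact ⟨α, hα.trans (Order.lt_add_one_iff.2 le_rfl), h'⟩
    · cases e
      exact ⟨β, Order.lt_add_one_iff.2 le_rfl, hpq.1, hpq.2.1⟩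
  | limit β hβ ih =>
    rw [stage_limit c hβ] at h
    rcases h with h | ⟨s, e, -⟩
    · obtain ⟨α, hα⟩ := mem_iUnion.1 h
      obtain ⟨α', hα', h'⟩ := ih α α.2 hα
      exact ⟨α', hα'.trans α.2, h'⟩
    · cases e

/-- One anchor belongs to the current generation, while an existing thread would put both anchors at
an earlier stage. Hence the names glued next are fresh and the formulas for new points apply to
them. -/
theorem thread_notMem_carrier {c : Choices} {β : Ordinal.{0}} {p q : Code}
    (h : (p, q) ∈ anchorPairs c (stage c β)) (γ : ℕ → ℝ) (t : ℝ) :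
    Code.thread p q γ t ∉ (stage c β).carrier := by
  intro hm
  obtain ⟨α, hα, hp, hq⟩ := anchors_of_thread_mem c β hm
  rcases h.2.2.1 with h' | h'
  · exact h'.2 ((stage_old c β).2 ⟨α, hα, hp⟩)
  · exact h'.2 ((stage_old c β).2 ⟨α, hα, hq⟩)

theorem threadDist_le_abs (l a x y : ℝ) : threadDist l a x y ≤ |x - y| := min_le_left _ _

/-- A new point of a threading space is at distance at most `|t - 0|` or `|t - 1|` from an
anchor. -/
theorem succDist_anchor_le {c : Choices} {X : Stage} (hX : IsMetricOn X.carrier X.d)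
    {p q : Code} {γ : ℕ → ℝ} {t : ℝ} (hm : Code.thread p q γ t ∈ (succStage c X).carrier)
    (h : Code.thread p q γ t ∉ X.carrier) (i : Bool) :
    succDist X (Code.thread p q γ t) (if i then q else p) ≤ |t - if i then 1 else 0| := by
  have hf := foot_mem hm i
  rw [foot_new h] at hf
  have h1 := succDist_le hX hm (Or.inl hf) i i
  rw [foot_new h, footDist_new h, foot_old hf, footDist_old hf, hX.self _ hf] at h1
  linarith [threadDist_le_abs 1 (X.d p q) t (if i then 1 else 0)]

/-! ## Uniformly locally constant predicates on skeins -/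

section Chain

variable {c : Choices} {κ : Ordinal.{0}} {G : Code → Prop} {ε : ℝ}

/-- The anchors of a threading space are joined by short steps along a thread. -/
theorem iff_of_anchorPair (hε : 0 < ε)
    (hG : ∀ x ∈ (stage c κ).carrier, ∀ y ∈ (stage c κ).carrier,
      (stage c κ).d x y < ε → (G x ↔ G y))
    {α : Ordinal.{0}} (hα : α + 1 ≤ κ) {p q : Code}
    (hpq : (p, q) ∈ anchorPairs c (stage c α)) : G p ↔ G q := by
  -- Divide `(0,1)` into `N = n + 1` open cells of length `1 / N < ε / 2`. Points of consecutive
  -- cells are then less than `2 / N < ε` apart.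
  obtain ⟨n, hn⟩ := exists_nat_one_div_lt (half_pos hε)
  set N : ℝ := (n : ℝ) + 1 with hN
  have hN0 : 0 < N := by positivity
  have hM := (stage_spec c α).1
  obtain ⟨hsub, hdist⟩ := (stage_spec c κ).2 (α + 1) hα
  rw [stage_add_one] at hsub hdist
  have hG' : ∀ x ∈ (succStage c (stage c α)).carrier,
      ∀ y ∈ (succStage c (stage c α)).carrier, succDist (stage c α) x y < ε → (G x ↔ G y) := by
    intro x hx y hy h
    exact hG x (hsub hx) y (hsub hy) (by rw [hdist x hx y hy]; exact h)
  -- With `r = 1 / N` the thread meets every cell.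
  obtain ⟨γ, hγ, hne⟩ := exists_delta_inter_Ioo_nonempty c.enum (r := 1 / N) (by positivity)
  have hnew : ∀ t ∈ threadSet c.enum γ, t ∈ Ioo (0 : ℝ) 1 →
      Code.thread p q γ t ∈ (succStage c (stage c α)).carrier := fun t ht h =>
    Or.inr ⟨p, q, γ, t, rfl, hpq, hγ, ht, h.1.ne', h.2.ne⟩
  have hnot := thread_notMem_carrier hpq γ
  have hIoo : ∀ k : ℕ, k ≤ n → ∀ t ∈ Ioo ((k : ℝ) / N) ((k + 1) / N), t ∈ Ioo (0 : ℝ) 1 := by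
    intro k hk t ht
    have hk' : (k : ℝ) ≤ n := by exact_mod_cast hk
    have h1 : ((k : ℝ) + 1) / N ≤ 1 := (div_le_one hN0).2 (by linarith)
    have h0 : 0 ≤ (k : ℝ) / N := by positivity
    exact ⟨h0.trans_lt ht.1, ht.2.trans_le h1⟩
  have ex : ∀ k : ℕ, k ≤ n → ∃ t ∈ threadSet c.enum γ, t ∈ Ioo ((k : ℝ) / N) ((k + 1) / N) := by
    intro k hk
    have hk' : (k : ℝ) ≤ n := by exact_mod_cast hk
    obtain ⟨t, h1, h2⟩ := hne ((k : ℝ) / N) ((k + 1) / N) (by positivity)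
      ((div_le_one hN0).2 (by linarith)) (by rw [← sub_div]; simp)
    exact ⟨t, h2, h1⟩
  -- The chain starts at `p`, within `1 / N` of the first cell's point, and passes from each cell to
  -- the next.
  have hp : ∀ k : ℕ, k ≤ n → ∃ t ∈ threadSet c.enum γ, t ∈ Ioo ((k : ℝ) / N) ((k + 1) / N) ∧
      (G (Code.thread p q γ t) ↔ G p) := by
    intro k
    induction k with
    | zero =>
      intro hk
      obtain ⟨t, ht, htI⟩ := ex _ hk
      have h01 := hIoo 0 hk t htI
      refine ⟨t, ht, htI, hG' _ (hnew t ht h01) _ (Or.inl hpq.1) ?_⟩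
      refine (succDist_anchor_le hM (hnew t ht h01) (hnot t) false).trans_lt ?_
      have h2 := htI.2
      simp only [Nat.cast_zero, zero_add] at h2
      simp only [Bool.false_eq_true, if_false, sub_zero, abs_of_pos h01.1]
      linarith
    | succ k ih =>
      intro hk
      obtain ⟨t, ht, htI, htG⟩ := ih (by omega)
      obtain ⟨t', ht', htI'⟩ := ex _ hk
      refine ⟨t', ht', htI', Iff.trans ?_ htG⟩
      refine hG' _ (hnew t' ht' (hIoo _ hk _ htI')) _
        (hnew t ht (hIoo _ (by omega) _ htI)) ?_
      rw [succDist_same (hnot _) (hnot _)]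
      refine (threadDist_le_abs _ _ _ _).trans_lt ?_
      obtain ⟨a1, a2⟩ := htI
      obtain ⟨b1, b2⟩ := htI'
      push_cast at b1 b2
      rw [add_div] at a2 b1 b2
      rw [add_div] at b2
      rw [abs_lt]
      constructor <;> linarith
  -- The point in the last cell is within `1 / N` of the other anchor.
  obtain ⟨t, ht, htI, htG⟩ := hp n le_rfl
  have h01 := hIoo n le_rfl t htI
  rw [← htG]
  refine hG' _ (hnew t ht h01) _ (Or.inl hpq.2.1) ?_
  refine (succDist_anchor_le hM (hnew t ht h01) (hnot t) true).trans_lt ?_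
  have h1 := htI.1
  have h2 : (n : ℝ) / N = 1 - 1 / N := by
    field_simp
    linarith
  simp only [if_true]
  rw [abs_of_neg (by linarith [h01.2])]
  linarith

/-- At the first stage containing both points, one of them is new, so the pair receives a threading
space at the next stage. That stage still embeds in stage `κ`, because `α < κ`. -/
theorem iff_of_dist_le_half (hε : 0 < ε)
    (hG : ∀ x ∈ (stage c κ).carrier, ∀ y ∈ (stage c κ).carrier,
      (stage c κ).d x y < ε → (G x ↔ G y))
    {α : Ordinal.{0}} (hα : α < κ) {p q : Code} (hp : p ∈ (stage c α).carrier)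
    (hq : q ∈ (stage c α).carrier) (h : (stage c α).d p q ≤ 1 / 2) : G p ↔ G q := by
  induction α using WellFoundedLT.induction with
  | ind α ih =>
  rcases eq_or_ne p q with rfl | hne
  · rfl
  -- If both points are old, a common earlier stage contains them at the same distance.
  by_cases hold : p ∈ (stage c α).old ∧ q ∈ (stage c α).old
  · obtain ⟨β, hβ, h1⟩ := (stage_old c α).1 hold.1
    obtain ⟨β', hβ', h2⟩ := (stage_old c α).1 hold.2
    have hm : max β β' < α := max_lt hβ hβ'
    have h1' := ((stage_spec c _).2 β (le_max_left β β')).1 h1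
    have h2' := ((stage_spec c _).2 β' (le_max_right β β')).1 h2
    refine ih _ hm (hm.trans hα) h1' h2' ?_
    rwa [← ((stage_spec c α).2 _ hm.le).2 p h1' q h2']
  · have hM := (stage_spec c α).1
    have hgen : p ∈ (stage c α).gen ∨ q ∈ (stage c α).gen := by
      by_contra hcon
      rw [not_or] at hcon
      exact hold ⟨by_contra fun h => hcon.1 ⟨hp, h⟩, by_contra fun h => hcon.2 ⟨hq, h⟩⟩
    have hpos : 0 < (stage c α).d p q :=
      (hM.nonneg hp hq).lt_of_ne fun h => hne (hM.eq p hp q hq h.symm)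
    have hα' : α + 1 ≤ κ := Order.add_one_le_of_lt hα
    by_cases ho : c.orient p q
    · exact iff_of_anchorPair hε hG hα' ⟨hp, hq, hgen, hpos, h, ho⟩
    · have hs := hM.symm p hp q hq
      exact (iff_of_anchorPair hε hG hα' ⟨hq, hp, hgen.symm, hs ▸ hpos, hs ▸ h,
        (c.orient_iff q p hne.symm).2 ho⟩).symm

/-- The points of a completion are limits of points of the space. -/
theorem exists_completionDist_lt {W : Set Code} {d : Code → Code → ℝ} (hd : IsMetricOn W d)
    (hε : 0 < ε) {x : Code} (hx : x ∈ W ∪ limitPoints W d) :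
    ∃ y ∈ W, completionDist W d x y < ε := by
  have hc := approx_cauchy hd hx
  -- `ε / 2` leaves room because the strict bound becomes weak in the limit.
  obtain ⟨N, hN⟩ := hc.2 (ε / 2) (half_pos hε)
  refine ⟨approx W x N, hc.1 N, ?_⟩
  have ht := completionDist_tendsto hd hx (Or.inl (hc.1 N))
  rw [approx_old (hc.1 N)] at ht
  refine (le_of_tendsto ht ?_).trans_lt (half_lt_self hε)
  filter_upwards [eventually_ge_atTop N] with n hn
  exact (hN n hn N le_rfl).le

/-- A predicate on a skein of limit order which cannot change within distance `ε` is constant. -/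
theorem iff_base_of_mem (hκ : Order.IsSuccLimit κ) (hε : 0 < ε)
    (hG : ∀ x ∈ (stage c κ).carrier, ∀ y ∈ (stage c κ).carrier,
      (stage c κ).d x y < ε → (G x ↔ G y))
    {β : Ordinal.{0}} (hβ : β ≤ κ) {x : Code} (hx : x ∈ (stage c β).carrier) :
    G x ↔ G (Code.base false) := by
  induction β using Ordinal.limitRecOn generalizing x with
  | zero =>
    -- The base points are at distance exactly `1/2`, which the threshold for gluing still admits.
    refine iff_of_dist_le_half hε hG hκ.bot_lt hx ?_ ?_
    · change _ ∈ (stage c 0).carrier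
      rw [stage_zero]
      simp [zeroStage]
    · change (stage c 0).d _ _ ≤ _
      rw [stage_zero]
      simp only [zeroStage]
      split_ifs <;> norm_num
  | add_one β ih =>
    have hlt : β < κ := (Order.lt_add_one_iff.2 le_rfl).trans_le hβ
    -- Here the limit hypothesis matters: a point new at stage `β + 1` must itself serve as an
    -- anchor at a later stage within `κ`.
    have hlt' : β + 1 < κ := by
      rw [← Order.succ_eq_add_one]
      exact hκ.succ_lt hlt
    by_cases hx' : x ∈ (stage c β).carrier
    · exact ih hlt.le hx'
    have hM := (stage_spec c β).1
    have hx0 := hx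
    rw [stage_add_one] at hx
    obtain ⟨p, q, γ, t, rfl, hp, hq, -, -, ht, -⟩ := new_spec hx hx'
    obtain ⟨i, hi⟩ : ∃ i : Bool, |t - if i then 1 else 0| ≤ 1 / 2 := by
      rcases le_total t (1 / 2) with h | h
      · exact ⟨false, by simpa [abs_of_nonneg ht.1] using h⟩
      · refine ⟨true, ?_⟩
        simp only [if_true]
        rw [abs_of_nonpos (by linarith [ht.2])]
        linarith
    have hf : (if i then q else p) ∈ (stage c β).carrier := by cases i <;> simpa
    rw [← ih hlt.le hf]
    -- The thread carrying the new point may have gaps longer than `ε`, so the chain does not follow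
    -- it; it uses a thread glued later between this point and its nearer anchor.
    refine iff_of_dist_le_half hε hG hlt' hx0 ?_ ?_
    · rw [stage_add_one]
      exact Or.inl hf
    · rw [stage_add_one]
      exact (succDist_anchor_le hM hx hx' i).trans hi
  | limit β hlim ih =>
    have hF : ∀ α α' : Iio β, α ≤ α' → Extends (stage c α) (stage c α') :=
      fun α α' h => (stage_spec c α').2 α h
    have hU := unionDist_isMetricOn (F := fun α : Iio β => stage c α)
      (fun α => (stage_spec c α).1) hF
    have hx0 := hx
    rw [stage_limit c hlim] at hx
    obtain ⟨y, hy, hxy⟩ := exists_completionDist_lt hU hε hx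
    have hy0 : y ∈ (stage c β).carrier := by
      rw [stage_limit c hlim]
      exact Or.inl hy
    obtain ⟨α, hα⟩ := mem_iUnion.1 hy
    rw [← ih α α.2 (α.2.le.trans hβ) hα]
    obtain ⟨hsub, hdist⟩ := (stage_spec c κ).2 β hβ
    refine hG x (hsub hx0) y (hsub hy0) ?_
    rw [hdist x hx0 y hy0, stage_limit c hlim]
    exact hxy

end Chain

end SkeinSpace

/-! ### Retractions onto a set with an isolated point -/

theorem mainTheorem4 (c : SkeinSpace.Choices) (S : Set (SkeinSpace.Sk c (Ordinal.omega 1)))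
    (hS : IsClosed S) (hS' : S.Nontrivial)
    (hiso : ∃ p ∈ S, ∃ U, IsOpen U ∧ U ∩ S = {p}) :
    ¬ SkeinSpace.IsLipschitzRetract S := by
  rintro ⟨R, K, hR, hfix⟩
  obtain ⟨p, hp, U, hU, hUS⟩ := hiso
  obtain ⟨q, hq, hqp⟩ := hS'.exists_ne p
  have hpU : p ∈ U := (hUS.ge rfl).1
  obtain ⟨δ, hδ, hball⟩ := Metric.isOpen_iff.1 hU p hpU
  -- `K + 1` replaces `K` so that the division is legitimate when `K = 0`.
  have hK : (0 : ℝ) < K + 1 := by positivity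
  have step : ∀ x y, dist x y < δ / (K + 1) → (R x : SkeinSpace.Sk c (Ordinal.omega 1)) = p →
      (R y : SkeinSpace.Sk c (Ordinal.omega 1)) = p := by
    intro x y hxy hx
    have h1 : dist (R y : SkeinSpace.Sk c (Ordinal.omega 1)) p < δ := by
      rw [← hx, ← Subtype.dist_eq, dist_comm]
      refine (hR.dist_le_mul x y).trans_lt ?_
      rw [lt_div_iff₀ hK] at hxy
      nlinarith [dist_nonneg (x := x) (y := y)]
    exact hUS.le ⟨hball h1, (R y).2⟩
  -- The predicate must be defined on all names, so it carries a proof of membership in the skein.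
  have key := fun x : SkeinSpace.Sk c (Ordinal.omega 1) =>
    SkeinSpace.iff_base_of_mem (c := c) (κ := Ordinal.omega 1)
    (G := fun x => ∃ h : x ∈ (SkeinSpace.stage c (Ordinal.omega 1)).carrier, (R ⟨x, h⟩).1 = p)
    (Cardinal.isSuccLimit_omega 1) (div_pos hδ hK)
    (fun x hx y hy h => ⟨fun ⟨_, e⟩ => ⟨hy, step ⟨x, hx⟩ ⟨y, hy⟩ h e⟩,
      fun ⟨_, e⟩ => ⟨hx, step ⟨y, hy⟩ ⟨x, hx⟩ ((dist_comm _ _).trans_lt h) e⟩⟩) le_rfl x.2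
  -- The predicate holds at `p`, hence at `q`; but `R` fixes `q`, so `q = p`.
  obtain ⟨_, e⟩ := ((key p).trans (key q).symm).1 ⟨p.2, congrArg Subtype.val (hfix ⟨p, hp⟩)⟩
  exact hqp ((congrArg Subtype.val (hfix ⟨q, hq⟩)).symm.trans e)
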